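/- For integers $n\ge 1$ and $k\ge 0$, let $\mathcal N(n,k)$ be the simplicial complex with vertex set $\{0,\dots,n-1\}$ (identified with $\mathbb Z/n$) whose maximal simplices are the discrete circular arcs $[i,i+k]_n$, $i=0,\dots,n-1$, where $[i,i+k]_n$ is the image of $\{i,i+1,\dots,i+k\}\subset\mathbb Z$ under the quotient map $\mathbb Z\to\mathbb Z/n$. Let $\Sigma$ denote unreduced suspension and $\simeq$ homotopy equivalence, where a simplicial complex is identified with its geometric realization. For all integers $n, k$ with $n\ge 1$ and $n/2\le k<n$, $$\mathcal N(n,k)\simeq \Sigma^2\,\mathcal N(k,2k-n).$$ -/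

import Mathlib

/-- The discrete circular arc `[i, j]_n`: the image of `{i, i + 1, …, j} ⊆ ℤ` under reduction
modulo `n`, where `Fin n = {0, …, n - 1}` is the standard set of representatives of `ℤ / n`. -/
def discreteArc (n : ℕ) (i j : ℤ) : Set (Fin n) :=
  {v | ∃ m : ℤ, i ≤ m ∧ m ≤ j ∧ m ≡ ((v : ℕ) : ℤ) [ZMOD (n : ℤ)]}

/-- The nerve complex `N(n, k)`: the abstract simplicial complex with vertex set `{0, …, n - 1}`
generated by the arcs `[i, i + k]_n`, `i = 0, …, n - 1`; its faces are the nonempty subsets of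
these arcs. All these arcs have the same number of elements, so they are its maximal simplices. -/
def nerveComplex (n k : ℕ) : AbstractSimplicialComplex (Fin n) where
  faces := {s | s.Nonempty ∧ ∃ i : Fin n,
    (s : Set (Fin n)) ⊆ discreteArc n ((i : ℕ) : ℤ) (((i : ℕ) : ℤ) + (k : ℤ))}
  isRelLowerSet_faces := by
    rintro s ⟨hs, i, hi⟩
    exact ⟨hs, fun t hts ht => ⟨ht, i, fun v hv => hi (hts hv)⟩⟩
  singleton_mem v := by
    refine ⟨Finset.singleton_nonempty v, v, ?_⟩
    intro w hw
    have hwv : w = v := by simpa using hw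
    subst hwv
    exact ⟨((w : ℕ) : ℤ), le_refl _, by omega, Int.ModEq.refl _⟩

/-- The geometric realization of an abstract simplicial complex on a finite type of vertices, in
barycentric coordinates: the points of the standard simplex whose support is contained in a face,
with the subspace topology of `ι → ℝ`. -/
def geomRealization {ι : Type*} [Fintype ι] (K : AbstractSimplicialComplex ι) : Set (ι → ℝ) :=
  {x | x ∈ stdSimplex ℝ ι ∧ ∃ s ∈ K.faces, ∀ v, x v ≠ 0 → v ∈ s}

/-- The gluing relation of the suspension: in the disjoint union of the cylinder `X × [0, 1]` and
two poles, each `(x, 0)` is glued to the first pole and each `(x, 1)` to the second. -/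
inductive SuspensionRel (X : Type*) : (X × unitInterval) ⊕ Bool → (X × unitInterval) ⊕ Bool → Prop
  | south (x : X) : SuspensionRel X (Sum.inl (x, 0)) (Sum.inr false)
  | north (x : X) : SuspensionRel X (Sum.inl (x, 1)) (Sum.inr true)

/-- The unreduced suspension of `X`: the quotient of the cylinder `X × [0, 1]` that collapses
`X × {0}` to one point and `X × {1}` to another. The two poles are added as separate points before
gluing, so that the suspension of the empty space consists of two points. -/
def Suspension (X : Type*) : Type _ :=
  Quot (SuspensionRel X)

/-- The suspension carries the quotient topology. -/
instance Suspension.instTopologicalSpace (X : Type*) [TopologicalSpace X] :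
    TopologicalSpace (Suspension X) :=
  inferInstanceAs (TopologicalSpace (Quot (SuspensionRel X)))

open scoped unitInterval

/-! Write `n = s + k`, so `1 ≤ s ≤ k` and `2k - n = k - s`. A nonempty set of vertices is a face of
N(n, k) iff it misses some cyclic window of `s - 1` consecutive vertices. Cut the vertices into the
first `s` and the last `k`. Each block spans a face, so the realization lies in the join of the
simplices Δ_k and Δ_s and contains both ends. It is therefore a cylinder over the space J of pairs
`(a, b)` with jointly admissible supports (`jointFaces`), with both ends capped by a contractible
set, hence a suspension of J (`nerveComplexSplit`, `homotopyEquivSuspension`).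

Project J to Δ_k. If the missed window fits inside the support gaps of `a`, the fibre over `a` is
all of Δ_s. Otherwise it is the union of two faces of Δ_s, on the initial segment `j ≤ min a` and on
the final segment `j ≥ max a - (k - s)`, where min and max run over the support of `a`. They meet
iff `max a - min a ≤ k - s`. A wide gap or this inequality is exactly the condition `a ∈ N(k, k -
s)`: the window in `ℤ/k` either does not wrap around or does. So the fibre is contractible over N(k,
k - s) and has two contractible pieces elsewhere. Thus J is two copies of Δ_k joined by a cylinder
over N(k, k - s), again a suspension (`jointFacesEquiv`).

The maps are explicit. From J, a height in `[0, 1]` tells the two pieces apart. Back to J, a broken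
line in Δ_s runs from vertex `0` to vertex `s - 1` through a point lying in both faces when they
meet. Truncating small coordinates of `a` gives the room needed for continuity: surviving vertices
have level exactly 1. All remaining homotopies are straight lines that stay inside one face, or move
only the height. -/

theorem ContinuousMap.homotopic_of_segment {X E : Type*} [TopologicalSpace X] [AddCommGroup E]
    [Module ℝ E] [TopologicalSpace E] [ContinuousAdd E] [ContinuousSMul ℝ E] {S : Set E}
    (f g : C(X, S))
    (h : ∀ x, ∀ r : ℝ, 0 ≤ r → r ≤ 1 → (1 - r) • (f x : E) + r • (g x : E) ∈ S) :
    f.Homotopic g :=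
  ⟨{ toFun := fun p => ⟨(1 - (p.1 : ℝ)) • (f p.2 : E) + (p.1 : ℝ) • (g p.2 : E),
        h p.2 p.1 p.1.2.1 p.1.2.2⟩
     continuous_toFun := by fun_prop
     map_zero_left := fun x => by simp
     map_one_left := fun x => by simp }⟩

/-! ### Suspensions: maps, homotopies, functoriality -/

namespace Suspension

variable {X Y Z : Type*}

def mk (x : X) (t : I) : Suspension X := Quot.mk _ (Sum.inl (x, t))

def pole (X : Type*) (b : Bool) : Suspension X := Quot.mk _ (Sum.inr b)

@[simp] theorem mk_zero (x : X) : mk x 0 = pole X false := Quot.sound (.south x)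

@[simp] theorem mk_one (x : X) : mk x 1 = pole X true := Quot.sound (.north x)

/-- Two functions on a suspension agree if they agree on the cylinder and on the poles. -/
theorem ind {p : Suspension X → Prop} (h : ∀ x t, p (mk x t)) (h' : ∀ b, p (pole X b)) (q) :
    p q := by
  refine Quot.ind ?_ q
  rintro (⟨x, t⟩ | b)
  · exact h x t
  · exact h' b

variable [TopologicalSpace X] [TopologicalSpace Y] [TopologicalSpace Z]

theorem continuous_mk : Continuous fun p : X × I => mk p.1 p.2 :=
  (continuous_quot_mk (r := SuspensionRel X)).comp continuous_inl

/-- The continuous map out of a suspension given by a map on the cylinder and the images of the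
poles. -/
def lift (F : C(X × I, Y)) (P : Bool → Y) (h0 : ∀ x, F (x, 0) = P false)
    (h1 : ∀ x, F (x, 1) = P true) : C(Suspension X, Y) where
  toFun := Quot.lift (Sum.elim F P) (by
    rintro _ _ (x | x)
    · exact h0 x
    · exact h1 x)
  continuous_toFun := continuous_quot_lift _
    (continuous_sumElim.2 ⟨F.continuous, continuous_of_discreteTopology⟩)

@[simp] theorem lift_mk (F : C(X × I, Y)) (P : Bool → Y) (h0 h1) (x : X) (t : I) :
    lift F P h0 h1 (mk x t) = F (x, t) := rfl

@[simp] theorem lift_pole (F : C(X × I, Y)) (P : Bool → Y) (h0 h1) (b : Bool) :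
    lift F P h0 h1 (pole X b) = P b := rfl

/-- Currying in the homotopy parameter turns the homotopy into a map from the quotient to `C(I, Y)`,
which avoids asking whether a quotient map times `I` is again a quotient map. -/
theorem homotopic (H : C((X × I) × I, Y)) (P : Bool → C(I, Y))
    (h0 : ∀ x r, H ((x, 0), r) = P false r) (h1 : ∀ x r, H ((x, 1), r) = P true r)
    {f g : C(Suspension X, Y)} (hf : ∀ x t, H ((x, t), 0) = f (mk x t))
    (hf' : ∀ b, P b 0 = f (pole X b)) (hg : ∀ x t, H ((x, t), 1) = g (mk x t))
    (hg' : ∀ b, P b 1 = g (pole X b)) : f.Homotopic g := by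
  let K : C(Suspension X, C(I, Y)) := lift H.curry P
    (fun x => by ext r; exact h0 x r) (fun x => by ext r; exact h1 x r)
  refine ⟨{ toFun := fun p => K p.2 p.1, continuous_toFun := ?_, map_zero_left := ?_,
            map_one_left := ?_ }⟩
  · exact (ContinuousMap.continuous_uncurry_of_continuous K).comp continuous_swap
  · exact ind hf hf'
  · exact ind hg hg'

/-- Functoriality of the suspension. -/
def map (f : C(X, Y)) : C(Suspension X, Suspension Y) :=
  lift ⟨fun p => mk (f p.1) p.2, continuous_mk.comp (by fun_prop : Continuous fun p : X × I =>
    (f p.1, p.2))⟩ (pole Y) (fun x => mk_zero _) (fun x => mk_one _)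

theorem map_homotopic {f g : C(X, Y)} (h : f.Homotopic g) : (map f).Homotopic (map g) := by
  obtain ⟨H⟩ := h
  refine homotopic ⟨fun p => mk (H (p.2, p.1.1)) p.1.2, continuous_mk.comp
    (by fun_prop : Continuous fun p : (X × I) × I => (H (p.2, p.1.1), p.1.2))⟩
    (fun b => .const _ (pole Y b)) ?_ ?_ ?_ ?_ ?_ ?_ <;> intros <;> simp [map]

theorem map_id : map (.id X) = .id (Suspension X) :=
  ContinuousMap.ext (ind (fun _ _ => rfl) fun _ => rfl)

theorem map_comp (g : C(Y, Z)) (f : C(X, Y)) : (map g).comp (map f) = map (g.comp f) :=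
  ContinuousMap.ext (ind (fun _ _ => rfl) fun _ => rfl)

def homotopyEquiv (e : ContinuousMap.HomotopyEquiv X Y) :
    ContinuousMap.HomotopyEquiv (Suspension X) (Suspension Y) where
  toFun := map e.toFun
  invFun := map e.invFun
  left_inv := by
    rw [map_comp, ← map_id]; exact map_homotopic e.left_inv
  right_inv := by
    rw [map_comp, ← map_id]; exact map_homotopic e.right_inv

end Suspension

/-! ### Capped cylinders with convex caps are suspensions -/

/-- The middle third of the unit interval stretched over the unit interval. -/
noncomputable def stretch (t : ℝ) : ℝ := max 0 (min 1 (3 * t - 1))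

@[fun_prop] theorem continuous_stretch : Continuous stretch := by unfold stretch; fun_prop

theorem stretch_nonneg (t : ℝ) : 0 ≤ stretch t := le_max_left _ _

theorem stretch_le_one (t : ℝ) : stretch t ≤ 1 := max_le zero_le_one (min_le_left _ _)

theorem stretch_eq_zero {t : ℝ} (h : t ≤ 1 / 3) : stretch t = 0 :=
  max_eq_left ((min_le_right _ _).trans (by linarith))

theorem stretch_eq_one {t : ℝ} (h : 2 / 3 ≤ t) : stretch t = 1 := by
  rw [stretch, min_eq_left (by linarith), max_eq_right zero_le_one]

theorem lt_of_stretch_pos {t : ℝ} (h : 0 < stretch t) : 1 / 3 < t := by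
  by_contra! h'
  exact h.ne' (stretch_eq_zero h')

theorem lt_of_stretch_lt_one {t : ℝ} (h : stretch t < 1) : t < 2 / 3 := by
  by_contra! h'
  exact h.ne (stretch_eq_one h')

/-- The union of `W × [0, 1]` with the two copies `C × {0}` and `C × {1}` of `C`. -/
def cappedCylinder {E : Type*} (C W : Set E) : Set (E × ℝ) :=
  {p | p.1 ∈ C ∧ 0 ≤ p.2 ∧ p.2 ≤ 1 ∧ (0 < p.2 → p.2 < 1 → p.1 ∈ W)}

namespace cappedCylinder

variable {E : Type*} {C W : Set E}

open Classical in
/-- Collapse the two caps to the poles. -/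
noncomputable def toSuspension (C W : Set E) (p : cappedCylinder C W) : Suspension W :=
  if h : 0 < p.1.2 ∧ p.1.2 < 1 then
    Suspension.mk ⟨p.1.1, p.2.2.2.2 h.1 h.2⟩
      ⟨stretch p.1.2, stretch_nonneg _, stretch_le_one _⟩
  else if p.1.2 ≤ 0 then Suspension.pole W false else Suspension.pole W true

theorem toSuspension_of_mem {p : cappedCylinder C W} (h : 0 < p.1.2 ∧ p.1.2 < 1) :
    toSuspension C W p = Suspension.mk ⟨p.1.1, p.2.2.2.2 h.1 h.2⟩
      ⟨stretch p.1.2, stretch_nonneg _, stretch_le_one _⟩ := dif_pos h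

theorem toSuspension_of_le {p : cappedCylinder C W} (h : p.1.2 ≤ 1 / 3) :
    toSuspension C W p = Suspension.pole W false := by
  unfold toSuspension
  split_ifs with h1 h2
  · rw [← Suspension.mk_zero]
    congr 1
    exact Subtype.ext (stretch_eq_zero h)
  · rfl
  · exact absurd ⟨not_le.1 h2, by linarith⟩ h1

theorem toSuspension_of_ge {p : cappedCylinder C W} (h : 2 / 3 ≤ p.1.2) :
    toSuspension C W p = Suspension.pole W true := by
  unfold toSuspension
  split_ifs with h1 h2
  · rw [← Suspension.mk_one]
    congr 1
    exact Subtype.ext (stretch_eq_one h)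
  · linarith
  · rfl

theorem stretch_mem {p : E × ℝ} (h : p ∈ cappedCylinder C W) :
    (p.1, stretch p.2) ∈ cappedCylinder C W :=
  ⟨h.1, stretch_nonneg _, stretch_le_one _, fun k0 k1 => h.2.2.2
    (by have := lt_of_stretch_pos k0; linarith) (by have := lt_of_stretch_lt_one k1; linarith)⟩

theorem mem_or_height_eq {p : E × ℝ} (h : p ∈ cappedCylinder C W) :
    p.1 ∈ W ∨ p.2 = stretch p.2 := by
  by_cases h0 : 0 < p.2
  · by_cases h1 : p.2 < 1
    · exact .inl (h.2.2.2 h0 h1)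
    · have : p.2 = 1 := le_antisymm h.2.2.1 (not_lt.1 h1)
      rw [this]
      exact .inr (stretch_eq_one (by norm_num)).symm
  · have : p.2 = 0 := le_antisymm (not_lt.1 h0) h.2.1
    rw [this]
    exact .inr (stretch_eq_zero (by norm_num)).symm

/-- The weight of the base point in the contraction of the caps. -/
noncomputable def capWeight (t : ℝ) : ℝ := min 1 (min (3 * t) (3 * (1 - t)))

@[fun_prop] theorem continuous_capWeight : Continuous capWeight := by unfold capWeight; fun_prop

theorem capWeight_nonneg {t : ℝ} (h0 : 0 ≤ t) (h1 : t ≤ 1) : 0 ≤ capWeight t :=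
  le_min zero_le_one (le_min (by linarith) (by linarith))

theorem capWeight_le_one (t : ℝ) : capWeight t ≤ 1 := min_le_left _ _

theorem capWeight_eq_one {t : ℝ} (h0 : 0 < stretch t) (h1 : stretch t < 1) : capWeight t = 1 := by
  have := lt_of_stretch_pos h0
  have := lt_of_stretch_lt_one h1
  exact min_eq_left (le_min (by linarith) (by linarith))

theorem capWeight_zero : capWeight 0 = 0 := by simp [capWeight]

theorem capWeight_one : capWeight 1 = 0 := by simp [capWeight]

/-- The base point may leave `W` only inside a cap. Whenever the stretched height is strictly
between 0 and 1, the weight is 1, so `c` is unchanged, and the original height is interior, so `c ∈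
W`. -/
theorem contract_mem [AddCommGroup E] [Module ℝ E] (hC : Convex ℝ C) {c₀ c : E} (hc₀ : c₀ ∈ C) {t : ℝ}
    (h : (c, t) ∈ cappedCylinder C W) :
    ((1 - capWeight t) • c₀ + capWeight t • c, stretch t) ∈ cappedCylinder C W := by
  obtain ⟨h1, h2, h3, h4⟩ := h
  refine ⟨hC hc₀ h1 (by linarith [capWeight_le_one t]) (capWeight_nonneg h2 h3) (by ring),
    stretch_nonneg _, stretch_le_one _, fun k0 k1 => ?_⟩
  have := lt_of_stretch_pos k0
  have := lt_of_stretch_lt_one k1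
  simp only [capWeight_eq_one k0 k1, sub_self, zero_smul, one_smul, zero_add]
  exact h4 (by dsimp only; linarith) (by dsimp only; linarith)

variable [TopologicalSpace E]

/-- Stretching makes the map constant near each cap, so the points of `C` outside `W` cause no
discontinuity; on the open middle it is a map to the cylinder. -/
theorem continuous_toSuspension : Continuous (toSuspension C W) := by
  have hs : Continuous fun p : cappedCylinder C W => p.1.2 := by fun_prop
  rw [continuous_iff_continuousAt]
  intro p
  rcases lt_or_ge p.1.2 (1 / 3) with h | h
  · refine ContinuousAt.congr (f := fun _ => Suspension.pole W false) continuousAt_const ?_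
    filter_upwards [hs.continuousAt.eventually_lt_const h] with q hq
    exact (toSuspension_of_le hq.le).symm
  rcases lt_or_ge (2 / 3) p.1.2 with h' | h'
  · refine ContinuousAt.congr (f := fun _ => Suspension.pole W true) continuousAt_const ?_
    filter_upwards [hs.continuousAt.eventually_const_lt h'] with q hq
    exact (toSuspension_of_ge hq.le).symm
  let U : Set (cappedCylinder C W) := {q | 0 < q.1.2 ∧ q.1.2 < 1}
  have hU : IsOpen U := (isOpen_lt continuous_const hs).inter (isOpen_lt hs continuous_const)
  refine ContinuousOn.continuousAt (s := U) ?_ (hU.mem_nhds ⟨by linarith, by linarith⟩)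
  rw [continuousOn_iff_continuous_domRestrict]
  have : U.domRestrict (toSuspension C W) = fun q : U =>
      Suspension.mk (⟨q.1.1.1, q.1.2.2.2.2 q.2.1 q.2.2⟩ : W)
        ⟨stretch q.1.1.2, stretch_nonneg _, stretch_le_one _⟩ :=
    funext fun q => toSuspension_of_mem q.2
  rw [this]
  exact Suspension.continuous_mk.comp (by fun_prop : Continuous fun q : U =>
    ((⟨q.1.1.1, q.1.2.2.2.2 q.2.1 q.2.2⟩ : W),
      (⟨stretch q.1.1.2, stretch_nonneg _, stretch_le_one _⟩ : I)))

variable [AddCommGroup E] [Module ℝ E] [ContinuousAdd E] [ContinuousSMul ℝ E]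

/-- Moving only the height is a homotopy as long as no point leaves the caps. -/
theorem homotopic_of_fst_eq {X : Type*} [TopologicalSpace X] (f g : C(X, cappedCylinder C W))
    (h : ∀ x, (f x).1.1 = (g x).1.1)
    (h' : ∀ x, (f x).1.1 ∈ W ∨ (f x).1.2 = (g x).1.2) :
    f.Homotopic g := by
  refine f.homotopic_of_segment g fun x r h0 h1 => ?_
  obtain ⟨f1, f2, f3, f4⟩ := (f x).2
  obtain ⟨g1, g2, g3, g4⟩ := (g x).2
  have e1 : ((1 - r) • (f x : E × ℝ) + r • (g x : E × ℝ)).1 = (f x).1.1 := by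
    simp only [Prod.fst_add, Prod.smul_fst, ← h, ← add_smul]; simp
  have e2 : ((1 - r) • (f x : E × ℝ) + r • (g x : E × ℝ)).2 = (1 - r) * (f x).1.2
    + r * (g x).1.2 := rfl
  refine ⟨e1 ▸ f1, e2 ▸ by nlinarith, e2 ▸ by nlinarith, fun k0 k1 => ?_⟩
  rw [e1]
  rcases h' x with h' | h'
  · exact h'
  · rw [e2, ← h'] at k0 k1
    exact f4 (by linarith) (by linarith)

/-- Moving only the base point inside the convex set `C` is a homotopy as long as the points
strictly between the caps are kept fixed. -/
theorem homotopic_of_snd_eq (hC : Convex ℝ C) {X : Type*} [TopologicalSpace X]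
    (f g : C(X, cappedCylinder C W)) (h : ∀ x, (f x).1.2 = (g x).1.2)
    (h' : ∀ x, 0 < (f x).1.2 → (f x).1.2 < 1 → (f x).1.1 = (g x).1.1) :
    f.Homotopic g := by
  refine f.homotopic_of_segment g fun x r h0 h1 => ?_
  obtain ⟨f1, f2, f3, f4⟩ := (f x).2
  obtain ⟨g1, g2, g3, g4⟩ := (g x).2
  have e1 : ((1 - r) • (f x : E × ℝ) + r • (g x : E × ℝ)).1 = (1 - r) • (f x).1.1
    + r • (g x).1.1 := rfl
  have e2 : ((1 - r) • (f x : E × ℝ) + r • (g x : E × ℝ)).2 = (f x).1.2 := by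
    have : ((1 - r) • (f x : E × ℝ) + r • (g x : E × ℝ)).2 = (1 - r) * (f x).1.2
      + r * (g x).1.2 := rfl
    rw [this, ← h]; ring
  refine ⟨e1 ▸ hC f1 g1 (by linarith) h0 (by ring), e2 ▸ f2, e2 ▸ f3, fun k0 k1 => ?_⟩
  rw [e2] at k0 k1
  rw [e1, ← h' x k0 k1, ← add_smul]
  simpa using f4 k0 k1

/-- Coning off both ends of the cylinder inside the caps. -/
noncomputable def ofSuspension (hC : Convex ℝ C) (hW : W ⊆ C) {c₀ : E} (hc₀ : c₀ ∈ C) :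
    C(Suspension W, cappedCylinder C W) :=
  Suspension.lift
    ⟨fun p => ⟨((1 - capWeight p.2) • c₀ + capWeight p.2 • p.1.1, stretch p.2),
      contract_mem hC hc₀ ⟨hW p.1.2, p.2.2.1, p.2.2.2, fun _ _ => p.1.2⟩⟩, by fun_prop⟩
    (fun b => ⟨(c₀, cond b 1 0), hc₀, by cases b <;> simp, by cases b <;> simp,
      by cases b <;> simp⟩)
    (fun x => Subtype.ext (by simp [capWeight_zero, stretch_eq_zero]))
    (fun x => Subtype.ext (by
      have : stretch 1 = 1 := stretch_eq_one (by norm_num)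
      simp [capWeight_one, this]))

/-- Stretching the height of a capped cylinder. -/
noncomputable def stretchMap (C W : Set E) : C(cappedCylinder C W, cappedCylinder C W) :=
  ⟨fun p => ⟨(p.1.1, stretch p.1.2), stretch_mem p.2⟩, by fun_prop⟩

theorem stretchMap_homotopic : (stretchMap C W).Homotopic (.id _) :=
  (homotopic_of_fst_eq (.id _) (stretchMap C W) (fun _ => rfl)
    fun x => mem_or_height_eq x.2).symm

/-- A cylinder with two convex caps is homotopy equivalent to the suspension. -/
noncomputable def homotopyEquivSuspension (hC : Convex ℝ C) (hW : W ⊆ C) {c₀ : E} (hc₀ : c₀ ∈ C) :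
    ContinuousMap.HomotopyEquiv (cappedCylinder C W) (Suspension W) where
  toFun := ⟨toSuspension C W, continuous_toSuspension⟩
  invFun := ofSuspension hC hW hc₀
  left_inv := by
    let S := stretchMap C W
    let K : C(cappedCylinder C W, cappedCylinder C W) :=
      ⟨fun p => ⟨_, contract_mem hC hc₀ p.2⟩, by fun_prop⟩
    have hK : K.Homotopic S := homotopic_of_snd_eq hC _ _ (fun _ => rfl) fun p h0 h1 => by
      simp [K, S, stretchMap, capWeight_eq_one h0 h1]
    have key : (ofSuspension hC hW hc₀).comp ⟨toSuspension C W, continuous_toSuspension⟩ =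
        K.comp S := by
      ext1 p
      by_cases h : 0 < p.1.2 ∧ p.1.2 < 1
      · simp only [ContinuousMap.comp_apply, ContinuousMap.coe_mk, toSuspension_of_mem h]
        rfl
      · rcases not_and_or.1 h with h | h
        · have h0 : p.1.2 = 0 := le_antisymm (not_lt.1 h) p.2.2.1
          have e : stretch 0 = 0 := stretch_eq_zero (by norm_num)
          simp only [ContinuousMap.comp_apply, ContinuousMap.coe_mk,
            toSuspension_of_le (show p.1.2 ≤ 1 / 3 by rw [h0]; norm_num)]
          refine Subtype.ext ?_
          simp [K, S, stretchMap, ofSuspension, h0, capWeight_zero, e]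
        · have h0 : p.1.2 = 1 := le_antisymm p.2.2.2.1 (not_lt.1 h)
          have e : stretch 1 = 1 := stretch_eq_one (by norm_num)
          simp only [ContinuousMap.comp_apply, ContinuousMap.coe_mk,
            toSuspension_of_ge (show 2 / 3 ≤ p.1.2 by rw [h0]; norm_num)]
          refine Subtype.ext ?_
          simp [K, S, stretchMap, ofSuspension, h0, capWeight_one, e]
    rw [key]
    exact (hK.comp (.refl S)).trans
      ((stretchMap_homotopic.comp (.refl S)).trans stretchMap_homotopic)
  right_inv := by
    have key : ∀ (w : W) (t : I), toSuspension C W (ofSuspension hC hW hc₀ (Suspension.mk w t)) =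
        Suspension.mk w ⟨stretch (stretch t), stretch_nonneg _, stretch_le_one _⟩ := by
      intro w t
      by_cases h : 0 < stretch (t : ℝ) ∧ stretch (t : ℝ) < 1
      · refine (toSuspension_of_mem h).trans ?_
        congr 1
        exact Subtype.ext (by simp [ofSuspension, capWeight_eq_one h.1 h.2])
      · rcases not_and_or.1 h with h | h
        · have h0 : stretch (t : ℝ) = 0 := le_antisymm (not_lt.1 h) (stretch_nonneg _)
          rw [toSuspension_of_le (show stretch (t : ℝ) ≤ 1 / 3 by rw [h0]; norm_num),
            ← Suspension.mk_zero w]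
          congr 1
          exact Subtype.ext (by simp [h0, stretch_eq_zero])
        · have h0 : stretch (t : ℝ) = 1 := le_antisymm (stretch_le_one _) (not_lt.1 h)
          rw [toSuspension_of_ge (show 2 / 3 ≤ stretch (t : ℝ) by rw [h0]; norm_num),
            ← Suspension.mk_one w]
          congr 1
          exact Subtype.ext (by simp [h0, stretch_eq_one (show (2 / 3 : ℝ) ≤ 1 by norm_num)])
    have e0 : stretch 0 = 0 := stretch_eq_zero (by norm_num)
    have e1 : stretch 1 = 1 := stretch_eq_one (by norm_num)
    -- Straight line from `stretch ∘ stretch` to the identity; it fixes 0 and 1, hence descends to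
    -- the suspension.
    let h : C(I × I, I) := ⟨fun p => ⟨(1 - (p.2 : ℝ)) * stretch (stretch p.1) + p.2 * p.1, by
      have := stretch_nonneg (stretch p.1)
      have := stretch_le_one (stretch p.1)
      obtain ⟨⟨t, _, _⟩, ⟨r, _, _⟩⟩ := p
      constructor <;> dsimp only at * <;> nlinarith⟩, by fun_prop⟩
    have h0 : ∀ r, h (0, r) = 0 := fun r => Subtype.ext (by simp [h, e0])
    have h1 : ∀ r, h (1, r) = 1 := fun r => Subtype.ext (by simp [h, e1])
    refine Suspension.homotopic ⟨fun p => Suspension.mk p.1.1 (h (p.1.2, p.2)),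
      Suspension.continuous_mk.comp (by fun_prop : Continuous fun p : (W × I) × I =>
        (p.1.1, h (p.1.2, p.2)))⟩ (fun b => .const _ (Suspension.pole W b)) ?_ ?_ ?_ ?_ ?_ ?_
    · intro x r; simp [h0]
    · intro x r; simp [h1]
    · intro x t
      simp only [ContinuousMap.comp_apply, ContinuousMap.coe_mk, key]
      congr 1
      exact Subtype.ext (by simp [h])
    · rintro (_ | _)
      · exact (toSuspension_of_le (by simp [ofSuspension])).symm
      · exact (toSuspension_of_ge (by simp [ofSuspension]; norm_num)).symm
    · intro x t
      change Suspension.mk x (h (t, 1)) = Suspension.mk x t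
      congr 1
      exact Subtype.ext (by simp [h])
    · intro b; rfl

end cappedCylinder

/-! ### Arcs and realizations by inequalities -/

theorem mem_discreteArc_iff {n k i : ℕ} (hk : k < n) (hi : i < n) (v : Fin n) :
    v ∈ discreteArc n (i : ℤ) ((i : ℤ) + (k : ℤ)) ↔
      (i ≤ v ∧ (v : ℕ) ≤ i + k) ∨ (v : ℕ) + n ≤ i + k := by
  have hv := v.2
  constructor
  · rintro ⟨m, h1, h2, h3⟩
    obtain ⟨c, hc⟩ := h3.symm.dvd
    have hc0 : 0 ≤ c := by
      by_contra! h
      have : (n : ℤ) * c ≤ n * (-1) := by gcongr; omega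
      omega
    have hc1 : c ≤ 1 := by
      by_contra! h
      have : (n : ℤ) * 2 ≤ n * c := by gcongr; omega
      omega
    obtain rfl | rfl : c = 0 ∨ c = 1 := by omega
    · left; omega
    · right; omega
  · rintro (h | h)
    · exact ⟨((v : ℕ) : ℤ), by omega, by omega, Int.ModEq.refl _⟩
    · exact ⟨(v : ℕ) + (n : ℤ), by omega, by omega, by simp [Int.ModEq]⟩

theorem exists_ne_zero_of_mem_stdSimplex {ι : Type*} [Fintype ι] {x : ι → ℝ}
    (hx : x ∈ stdSimplex ℝ ι) : ∃ i, x i ≠ 0 := by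
  by_contra! h
  have := hx.2
  simp [h] at this

theorem mem_geomRealization_nerveComplex {n k : ℕ} (hk : k < n) {x : Fin n → ℝ} :
    x ∈ geomRealization (nerveComplex n k) ↔ x ∈ stdSimplex ℝ (Fin n) ∧ ∃ i < n, ∀ v, x v ≠ 0 →
      (i ≤ v ∧ (v : ℕ) ≤ i + k) ∨ (v : ℕ) + n ≤ i + k := by
  refine and_congr_right fun hx => ⟨?_, ?_⟩
  · rintro ⟨s, ⟨_, i, hi⟩, h⟩
    exact ⟨i, i.2, fun v hv => (mem_discreteArc_iff hk i.2 v).1 (hi (h v hv))⟩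
  · rintro ⟨i, hi, h⟩
    obtain ⟨v, hv⟩ := exists_ne_zero_of_mem_stdSimplex hx
    refine ⟨Finset.univ.filter (x · ≠ 0), ⟨⟨v, by simpa using hv⟩, ⟨i, hi⟩, fun w hw => ?_⟩,
      fun w hw => by simpa using hw⟩
    exact (mem_discreteArc_iff hk hi w).2 (h w (by simpa using hw))

/-- Used for homotopies that never enlarge the support. -/
theorem mem_geomRealization_of_support {ι : Type*} [Fintype ι] {K : AbstractSimplicialComplex ι}
    {x y : ι → ℝ} (hx : x ∈ geomRealization K) (hy : y ∈ stdSimplex ℝ ι)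
    (h : ∀ v, x v = 0 → y v = 0) : y ∈ geomRealization K := by
  obtain ⟨-, s, hs, h'⟩ := hx
  exact ⟨hy, s, hs, fun v hv => h' v (mt (h v) hv)⟩

/-! ### Faces relative to the cut into `s` and `k` vertices -/

section Support

variable {s k : ℕ}

/-- The support of `a` misses a window of `s - 1` consecutive vertices, where the vertices are
extended by `s` free places beyond each of the two ends of `Fin k`. -/
def HasWideGap (s : ℕ) (a : Fin k → ℝ) : Prop :=
  ∃ i : ℕ, s ≤ i + 1 ∧ i ≤ k ∧ ∀ u, a u ≠ 0 → i ≤ u ∨ (u : ℕ) + s ≤ i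

/-- The missed window straddles the junction from the end of the `s`-block to the start of the
`k`-block. For fixed `a` this allows an initial face of the `s`-simplex. -/
def SupportBelow (a : Fin k → ℝ) (b : Fin s → ℝ) : Prop :=
  ∀ u j, a u ≠ 0 → b j ≠ 0 → (j : ℕ) ≤ u

/-- The missed window straddles the other junction, from the end of the `k`-block to the start of
the `s`-block. For fixed `a` this allows a final face. -/
def SupportAbove (a : Fin k → ℝ) (b : Fin s → ℝ) : Prop :=
  ∀ u j, a u ≠ 0 → b j ≠ 0 → (u : ℕ) + s ≤ j + k

/-- The pairs of points of two simplices whose supports jointly span a face of the nerve complex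
on `s + k` vertices. -/
def jointFaces (s k : ℕ) : Set ((Fin k → ℝ) × (Fin s → ℝ)) :=
  {p | p.1 ∈ stdSimplex ℝ (Fin k) ∧ p.2 ∈ stdSimplex ℝ (Fin s) ∧
    (HasWideGap s p.1 ∨ SupportBelow p.1 p.2 ∨ SupportAbove p.1 p.2)}

theorem HasWideGap.mono {a a' : Fin k → ℝ} (h : HasWideGap s a) (ha : ∀ u, a u = 0 → a' u = 0) :
    HasWideGap s a' := by
  obtain ⟨i, h1, h2, h3⟩ := h
  exact ⟨i, h1, h2, fun u hu => h3 u (mt (ha u) hu)⟩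

theorem SupportBelow.mono {a a' : Fin k → ℝ} {b b' : Fin s → ℝ} (h : SupportBelow a b)
    (ha : ∀ u, a u = 0 → a' u = 0) (hb : ∀ j, b j = 0 → b' j = 0) : SupportBelow a' b' :=
  fun u j hu hj => h u j (mt (ha u) hu) (mt (hb j) hj)

theorem SupportAbove.mono {a a' : Fin k → ℝ} {b b' : Fin s → ℝ} (h : SupportAbove a b)
    (ha : ∀ u, a u = 0 → a' u = 0) (hb : ∀ j, b j = 0 → b' j = 0) : SupportAbove a' b' :=
  fun u j hu hj => h u j (mt (ha u) hu) (mt (hb j) hj)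

theorem jointFaces_of_support {a a' : Fin k → ℝ} {b b' : Fin s → ℝ} (h : (a, b) ∈ jointFaces s k)
    (ha' : a' ∈ stdSimplex ℝ (Fin k)) (hb' : b' ∈ stdSimplex ℝ (Fin s))
    (ha : ∀ u, a u = 0 → a' u = 0) (hb : ∀ j, b j = 0 → b' j = 0) : (a', b') ∈ jointFaces s k :=
  ⟨ha', hb', h.2.2.imp (fun h => h.mono ha) (Or.imp (fun h => h.mono ha hb) fun h => h.mono ha hb)⟩

/-- The arc starting at `i` misses the `s - 1` vertices cyclically preceding `i`. The three
alternatives are the positions of this window: inside the `k`-block, or reaching over one of the two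
junctions. -/
theorem exists_arc_iff (hs : 1 ≤ s) (hsk : s ≤ k) {a : Fin k → ℝ} {b : Fin s → ℝ}
    (ha : ∃ u, a u ≠ 0) (hb : ∃ j, b j ≠ 0) :
    (∃ i < s + k, (∀ j, b j ≠ 0 → (i ≤ j ∧ (j : ℕ) ≤ i + k) ∨ (j : ℕ) + (s + k) ≤ i + k) ∧
      ∀ u, a u ≠ 0 → (i ≤ s + u ∧ s + u ≤ i + k) ∨ s + u + (s + k) ≤ i + k) ↔
    HasWideGap s a ∨ SupportBelow a b ∨ SupportAbove a b := by
  constructor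
  · rintro ⟨i, hi, h1, h2⟩
    by_cases his : i < s
    · refine .inr (.inr fun u j hu hj => ?_)
      have := h1 j hj; have := h2 u hu
      omega
    by_cases hi' : s ≤ i - s + 1
    · refine .inl ⟨i - s, hi', by omega, fun u hu => ?_⟩
      have := h2 u hu
      omega
    · refine .inr (.inl fun u j hu hj => ?_)
      have := h1 j hj; have := h2 u hu; have := j.2
      omega
  · rintro (⟨i, h1, h2, h3⟩ | h | h)
    -- For `i = k` the arc would start at `s + k`, which is vertex `0` modulo `s + k`.
    · by_cases hik : i < k
      · refine ⟨s + i, by omega, fun j _ => ?_, fun u hu => ?_⟩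
        · have := j.2; omega
        · have := h3 u hu; have := u.2
          omega
      · refine ⟨0, by omega, fun j _ => ?_, fun u hu => ?_⟩
        · have := j.2; omega
        · have := h3 u hu; have := u.2
          omega
    · obtain ⟨m, hm, hmin⟩ := Finset.exists_min_image (Finset.univ.filter (a · ≠ 0)) id
        (by obtain ⟨u, hu⟩ := ha; exact ⟨u, by simpa using hu⟩)
      have hm : a m ≠ 0 := by simpa using hm
      refine ⟨s + m, by omega, fun j hj => ?_, fun u hu => ?_⟩
      · have := h m j hm hj; omega
      · have : (m : ℕ) ≤ u := hmin u (by simpa using hu)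
        omega
    · obtain ⟨m, hm, hmin⟩ := Finset.exists_min_image (Finset.univ.filter (b · ≠ 0)) id
        (by obtain ⟨u, hu⟩ := hb; exact ⟨u, by simpa using hu⟩)
      have hm : b m ≠ 0 := by simpa using hm
      refine ⟨m, by omega, fun j hj => ?_, fun u hu => ?_⟩
      · have : (m : ℕ) ≤ j := hmin j (by simpa using hj)
        omega
      · have := h u m hu hm; omega

/-- Here the missed window of `s - 1` places lies in `ℤ/k`: either it does not wrap around, giving a
wide gap, or the support has spread at most `k - s`. -/
theorem mem_geomRealization_nerveComplex_sub (hs : 1 ≤ s) (hsk : s ≤ k) {a : Fin k → ℝ} :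
    a ∈ geomRealization (nerveComplex k (2 * k - (s + k))) ↔ a ∈ stdSimplex ℝ (Fin k) ∧
      (HasWideGap s a ∨ ∀ u w, a u ≠ 0 → a w ≠ 0 → (w : ℕ) + s ≤ u + k) := by
  rw [mem_geomRealization_nerveComplex (by omega)]
  refine and_congr_right fun ha => ⟨?_, ?_⟩
  · rintro ⟨i, hi, h⟩
    by_cases his : s ≤ i + 1
    · exact .inl ⟨i, his, hi.le, fun u hu => by have := h u hu; omega⟩
    · refine .inr fun u w hu hw => ?_
      have := h u hu; have := h w hw
      omega
  · rintro (⟨i, h1, h2, h3⟩ | h)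
    · by_cases hik : i < k
      · exact ⟨i, hik, fun u hu => by have := h3 u hu; omega⟩
      · exact ⟨0, by omega, fun u hu => by have := h3 u hu; omega⟩
    · obtain ⟨m, hm, hmin⟩ := Finset.exists_min_image (Finset.univ.filter (a · ≠ 0)) id
        (by obtain ⟨u, hu⟩ := exists_ne_zero_of_mem_stdSimplex ha; exact ⟨u, by simpa using hu⟩)
      have hm : a m ≠ 0 := by simpa using hm
      refine ⟨m, m.2, fun u hu => ?_⟩
      have : (m : ℕ) ≤ u := hmin u (by simpa using hu)
      have := h m u hm hu
      omega

end Support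

/-! ### The nerve complex as a capped cylinder inside a join -/

section Rescale

variable {ι : Type*} [Fintype ι]

/-- Normalize the nonnegative vector `y` when its mass is at least `1 / 3`, and interpolate
to `c` when the mass is smaller. -/
noncomputable def rescale (c y : ι → ℝ) : ι → ℝ := fun i =>
  y i / max (∑ j, y j) (1 / 3) + (1 - (∑ j, y j) / max (∑ j, y j) (1 / 3)) * c i

theorem max_third_ne_zero (t : ℝ) : max t (1 / 3) ≠ 0 :=
  (lt_of_lt_of_le (by norm_num : (0 : ℝ) < 1 / 3) (le_max_right _ _)).ne'

@[fun_prop] theorem continuous_rescale (c : ι → ℝ) : Continuous (rescale c) := by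
  unfold rescale
  refine continuous_pi fun i => ?_
  refine .add (.div (by fun_prop) (by fun_prop) fun y => max_third_ne_zero _)
    (.mul (.sub continuous_const (.div (by fun_prop) (by fun_prop) fun y => max_third_ne_zero _))
      continuous_const)

theorem rescale_mem {c y : ι → ℝ} (hc : c ∈ stdSimplex ℝ ι) (hy : ∀ i, 0 ≤ y i) :
    rescale c y ∈ stdSimplex ℝ ι := by
  have hm := max_third_ne_zero (∑ j, y j)
  have h0 : 0 < max (∑ j, y j) (1 / 3) := lt_of_le_of_ne (le_trans (by norm_num)
    (le_max_right _ _)) hm.symm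
  refine ⟨fun i => add_nonneg (div_nonneg (hy i) h0.le) (mul_nonneg ?_ (hc.1 i)), ?_⟩
  · rw [sub_nonneg, div_le_one h0]
    exact le_max_left _ _
  · simp only [rescale]
    rw [Finset.sum_add_distrib, ← Finset.sum_div, ← Finset.mul_sum, hc.2]
    ring

theorem rescale_eq {c y : ι → ℝ} (h : 1 / 3 ≤ ∑ j, y j) :
    rescale c y = fun i => y i / ∑ j, y j := by
  have h0 : ∑ j, y j ≠ 0 := by linarith
  ext i
  simp only [rescale, max_eq_left h, div_self h0]
  ring

theorem rescale_apply_eq_zero {c y : ι → ℝ} (h : 1 / 3 ≤ ∑ j, y j) {i : ι} (hi : y i = 0) :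
    rescale c y i = 0 := by
  rw [rescale_eq h]
  simp [hi]

theorem rescale_smul {c y : ι → ℝ} (hy : y ∈ stdSimplex ℝ ι) {t : ℝ} (ht : 1 / 3 ≤ t) :
    rescale c (t • y) = y := by
  have h0 : ∑ j, (t • y) j = t := by simp [← Finset.mul_sum, hy.2]
  rw [rescale_eq (by rw [h0]; exact ht), h0]
  ext i
  have : t ≠ 0 := by linarith
  simp [this]

end Rescale

section Join

variable {s k : ℕ}

theorem append_mem_stdSimplex {a : Fin k → ℝ} {b : Fin s → ℝ} (ha : a ∈ stdSimplex ℝ (Fin k))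
    (hb : b ∈ stdSimplex ℝ (Fin s)) {t : ℝ} (h0 : 0 ≤ t) (h1 : t ≤ 1) :
    Fin.append (t • b) ((1 - t) • a) ∈ stdSimplex ℝ (Fin (s + k)) := by
  refine ⟨fun v => ?_, ?_⟩
  · induction v using Fin.addCases with
    | left j => simpa using mul_nonneg h0 (hb.1 j)
    | right u => simpa using mul_nonneg (sub_nonneg.2 h1) (ha.1 u)
  · simp [Fin.sum_univ_add, ← Finset.mul_sum, ha.2, hb.2]

theorem append_mem_geomRealization (hs : 1 ≤ s) (hsk : s ≤ k)
    {p : ((Fin k → ℝ) × (Fin s → ℝ)) × ℝ}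
    (hp : p ∈ cappedCylinder (stdSimplex ℝ (Fin k) ×ˢ stdSimplex ℝ (Fin s)) (jointFaces s k)) :
    Fin.append (p.2 • p.1.2) ((1 - p.2) • p.1.1) ∈ geomRealization (nerveComplex (s + k) k) := by
  obtain ⟨⟨a, b⟩, t⟩ := p
  obtain ⟨⟨ha, hb⟩, h0, h1, h⟩ := hp
  dsimp only at *
  rw [mem_geomRealization_nerveComplex (by omega)]
  refine ⟨append_mem_stdSimplex ha hb h0 h1, ?_⟩
  rcases h0.eq_or_lt with rfl | h0
  · refine ⟨s, by omega, fun v => ?_⟩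
    induction v using Fin.addCases with
    | left j => simp
    | right u => intro; left; simp
  rcases h1.eq_or_lt with rfl | h1
  · refine ⟨0, by omega, fun v => ?_⟩
    induction v using Fin.addCases with
    | left j => intro; left; simp; omega
    | right u => simp
  obtain ⟨i, hi, h2, h3⟩ := (exists_arc_iff hs hsk (exists_ne_zero_of_mem_stdSimplex ha)
    (exists_ne_zero_of_mem_stdSimplex hb)).2 (h h0 h1).2.2
  refine ⟨i, hi, fun v hv => ?_⟩
  induction v using Fin.addCases with
  | left j => exact h2 j (by simp at hv; exact hv.2)
  | right u => exact h3 u (by simp at hv; exact hv.2)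

theorem rescale_mem_cappedCylinder (hs : 1 ≤ s) (hsk : s ≤ k) {a₀ : Fin k → ℝ} {b₀ : Fin s → ℝ}
    (ha₀ : a₀ ∈ stdSimplex ℝ (Fin k)) (hb₀ : b₀ ∈ stdSimplex ℝ (Fin s)) {x : Fin (s + k) → ℝ}
    (hx : x ∈ geomRealization (nerveComplex (s + k) k)) :
    ((rescale a₀ fun u => x (Fin.natAdd s u), rescale b₀ fun j => x (Fin.castAdd k j)),
      stretch (∑ j : Fin s, x (Fin.castAdd k j))) ∈
      cappedCylinder (stdSimplex ℝ (Fin k) ×ˢ stdSimplex ℝ (Fin s)) (jointFaces s k) := by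
  have hA := rescale_mem ha₀ fun u => hx.1.1 (Fin.natAdd s u)
  have hB := rescale_mem hb₀ fun u => hx.1.1 (Fin.castAdd k u)
  have hsum := hx.1.2
  rw [Fin.sum_univ_add] at hsum
  refine ⟨⟨hA, hB⟩, stretch_nonneg _, stretch_le_one _, fun h0 h1 => ⟨hA, hB, ?_⟩⟩
  have t0 := lt_of_stretch_pos h0
  have t1 := lt_of_stretch_lt_one h1
  rw [← exists_arc_iff hs hsk (exists_ne_zero_of_mem_stdSimplex hA)
    (exists_ne_zero_of_mem_stdSimplex hB)]
  rw [mem_geomRealization_nerveComplex (by omega)] at hx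
  obtain ⟨-, i, hi, h⟩ := hx
  refine ⟨i, hi, fun j hj => ?_, fun u hu => ?_⟩
  · refine h (Fin.castAdd k j) fun h' => hj ?_
    exact rescale_apply_eq_zero t0.le h'
  · refine h (Fin.natAdd s u) fun h' => hu ?_
    exact rescale_apply_eq_zero (by linarith) h'

/-- The nerve complex on `s + k` vertices, cut along the first `s` vertices. -/
noncomputable def nerveComplexSplit (hs : 1 ≤ s) (hsk : s ≤ k) :
    ContinuousMap.HomotopyEquiv (geomRealization (nerveComplex (s + k) k))
      (cappedCylinder (stdSimplex ℝ (Fin k) ×ˢ stdSimplex ℝ (Fin s)) (jointFaces s k)) := by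
  have ha₀ := single_mem_stdSimplex ℝ (⟨0, by omega⟩ : Fin k)
  have hb₀ := single_mem_stdSimplex ℝ (⟨0, by omega⟩ : Fin s)
  have hx (v) : Continuous fun x : geomRealization (nerveComplex (s + k) k) => x.1 v :=
    (continuous_apply v).comp continuous_subtype_val
  let F : C(geomRealization (nerveComplex (s + k) k),
      cappedCylinder (stdSimplex ℝ (Fin k) ×ˢ stdSimplex ℝ (Fin s)) (jointFaces s k)) :=
    ⟨fun x => ⟨_, rescale_mem_cappedCylinder hs hsk ha₀ hb₀ x.2⟩, .subtype_mk (.prodMk (.prodMk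
      ((continuous_rescale _).comp (continuous_pi fun _ => hx _))
      ((continuous_rescale _).comp (continuous_pi fun _ => hx _)))
      (continuous_stretch.comp (continuous_finsetSum _ fun _ _ => hx _))) _⟩
  let G : C(cappedCylinder (stdSimplex ℝ (Fin k) ×ˢ stdSimplex ℝ (Fin s)) (jointFaces s k),
      geomRealization (nerveComplex (s + k) k)) :=
    ⟨fun p => ⟨_, append_mem_geomRealization hs hsk p.2⟩, by
      refine Continuous.subtype_mk (continuous_pi fun v => ?_) _
      induction v using Fin.addCases with
      | left j => simp only [Fin.append_left]; fun_prop
      | right u => simp only [Fin.append_right]; fun_prop⟩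
  refine ⟨F, G, ?_, ?_⟩
  -- `G ∘ F` never enlarges the support: rescaling adds vertices to a block only if its mass is
  -- below 1/3, and then the stretched height gives that block weight 0.
  · refine ContinuousMap.Homotopic.symm (ContinuousMap.homotopic_of_segment _ _ fun x r h0 h1 => ?_)
    refine mem_geomRealization_of_support x.2
      (convex_stdSimplex ℝ _ x.2.1 (G (F x)).2.1 (by linarith) h0 (by ring)) fun v hv => ?_
    have hsum := x.2.1.2
    rw [Fin.sum_univ_add] at hsum
    suffices (G (F x)).1 v = 0 by simp [hv, this]
    induction v using Fin.addCases with
    | left j =>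
      simp only [G, F, ContinuousMap.coe_mk, Fin.append_left, Pi.smul_apply, smul_eq_mul,
        mul_eq_zero]
      by_cases h : ∑ j : Fin s, x.1 (Fin.castAdd k j) ≤ 1 / 3
      · exact .inl (stretch_eq_zero h)
      · exact .inr (rescale_apply_eq_zero (not_le.1 h).le hv)
    | right u =>
      simp only [G, F, ContinuousMap.coe_mk, Fin.append_right, Pi.smul_apply, smul_eq_mul,
        mul_eq_zero]
      by_cases h : 2 / 3 ≤ ∑ j : Fin s, x.1 (Fin.castAdd k j)
      · exact .inl (by rw [stretch_eq_one h, sub_self])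
      · exact .inr (rescale_apply_eq_zero (by linarith) hv)
  · refine ContinuousMap.Homotopic.trans (.symm ?_) cappedCylinder.stretchMap_homotopic
    have hsum : ∀ p : cappedCylinder (stdSimplex ℝ (Fin k) ×ˢ stdSimplex ℝ (Fin s))
        (jointFaces s k), ∑ j, (G p).1 (Fin.castAdd k j) = p.1.2 := fun p => by
      simp [G, ← Finset.mul_sum, p.2.1.2.2]
    -- Strictly between the caps both masses exceed 1/3, so rescaling recovers both base points
    -- exactly.
    refine cappedCylinder.homotopic_of_snd_eq
      ((convex_stdSimplex ℝ _).prod (convex_stdSimplex ℝ _)) _ _ (fun p => ?_) fun p h0 h1 => ?_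
    · exact (congrArg stretch (hsum p)).symm
    · have t0 := lt_of_stretch_pos h0
      have t1 := lt_of_stretch_lt_one h1
      have ea : (fun u => (G p).1 (Fin.natAdd s u)) = (1 - p.1.2) • p.1.1.1 := by
        ext u; simp [G]
      have eb : (fun j => (G p).1 (Fin.castAdd k j)) = p.1.2 • p.1.1.2 := by
        ext j; simp [G]
      refine Prod.ext ?_ ?_
      · change _ = rescale _ fun u => (G p).1 (Fin.natAdd s u)
        rw [ea, rescale_smul p.2.1.1 (by linarith)]
        rfl
      · change _ = rescale _ fun j => (G p).1 (Fin.castAdd k j)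
        rw [eb, rescale_smul p.2.1.2 (by linarith)]
        rfl

end Join

/-! ### Truncation and the path between the two pieces of a fibre -/

section Bridge

variable {s k : ℕ}

/-- The coordinates of `a` relative to the threshold `1 / (2 * k)`, cut off at `1`. -/
noncomputable def level (a : Fin k → ℝ) (u : Fin k) : ℝ := min (2 * k * a u) 1

@[fun_prop] theorem continuous_level : Continuous (level (k := k)) := by
  unfold level; fun_prop

theorem level_nonneg {a : Fin k → ℝ} (ha : a ∈ stdSimplex ℝ (Fin k)) (u : Fin k) :
    0 ≤ level a u :=
  le_min (mul_nonneg (by positivity) (ha.1 u)) zero_le_one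

theorem level_le_one (a : Fin k → ℝ) (u : Fin k) : level a u ≤ 1 := min_le_right _ _

theorem level_eq_zero {a : Fin k → ℝ} {u : Fin k} (h : a u = 0) : level a u = 0 := by
  simp [level, h]

/-- Drop the coordinates below the threshold `1 / (2 * k)` and normalize. -/
noncomputable def truncate (a : Fin k → ℝ) : Fin k → ℝ := fun u =>
  max (2 * k * a u - 1) 0 / max (∑ w, max (2 * k * a w - 1) 0) 1

@[fun_prop] theorem continuous_truncate : Continuous (truncate (k := k)) := by
  unfold truncate
  refine continuous_pi fun u => .div (by fun_prop) (by fun_prop) fun a => ?_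
  exact (zero_lt_one.trans_le (le_max_right _ _)).ne'

/-- The threshold is half the average coordinate `1 / k`, so the excesses add up to at least `2k - k
= k ≥ 1` and the denominator is their true sum. -/
theorem truncate_mem {a : Fin k → ℝ} (ha : a ∈ stdSimplex ℝ (Fin k)) :
    truncate a ∈ stdSimplex ℝ (Fin k) := by
  have h1 : 1 ≤ ∑ w, max (2 * k * a w - 1) 0 := by
    have hk : (1 : ℝ) ≤ k := by
      obtain ⟨u, -⟩ := exists_ne_zero_of_mem_stdSimplex ha
      exact_mod_cast u.pos
    calc (1 : ℝ) ≤ ∑ w, (2 * k * a w - 1) := by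
          rw [Finset.sum_sub_distrib, ← Finset.mul_sum, ha.2]
          simp
          linarith
      _ ≤ _ := Finset.sum_le_sum fun _ _ => le_max_left _ _
  unfold truncate
  rw [max_eq_left h1]
  refine ⟨fun u => div_nonneg (le_max_right _ _) (by linarith), ?_⟩
  rw [← Finset.sum_div, div_self (by linarith)]

theorem level_of_truncate_ne_zero {a : Fin k → ℝ} {u : Fin k} (h : truncate a u ≠ 0) :
    level a u = 1 := by
  refine min_eq_right ?_
  by_contra! h'
  exact h (by simp [truncate, max_eq_right (show 2 * k * a u - 1 ≤ 0 by linarith)])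

theorem truncate_eq_zero {a : Fin k → ℝ} {u : Fin k} (h : a u = 0) : truncate a u = 0 := by
  by_contra h'
  have := level_of_truncate_ne_zero h'
  rw [level_eq_zero h] at this
  exact zero_ne_one this

theorem truncate_truncate_eq_zero {a : Fin k → ℝ} (u : Fin k) (h : a u = 0) :
    truncate (truncate a) u = 0 :=
  truncate_eq_zero (truncate_eq_zero h)

/-- The breaking ratios of `firstVertex`. -/
noncomputable def breakRatio (hsk : s ≤ k) (a : Fin k → ℝ) (j : Fin s) : ℝ :=
  if (j : ℕ) + 1 = s then 1 else level a (j.castLE hsk)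

theorem breakRatio_mem (hsk : s ≤ k) {a : Fin k → ℝ} (ha : a ∈ stdSimplex ℝ (Fin k)) (j : Fin s) :
    0 ≤ breakRatio hsk a j ∧ breakRatio hsk a j ≤ 1 := by
  unfold breakRatio
  split_ifs
  · simp
  · exact ⟨level_nonneg ha _, level_le_one _ _⟩

@[fun_prop] theorem continuous_breakRatio (hsk : s ≤ k) : Continuous (breakRatio hsk) := by
  unfold breakRatio
  refine continuous_pi fun j => ?_
  split_ifs <;> fun_prop

/-- A continuous choice, by stick breaking, of a point of a simplex on `s` vertices that
lies close to the first vertex in the support of `a`, or to the last vertex if there is none. -/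
noncomputable def firstVertex (hsk : s ≤ k) (a : Fin k → ℝ) (j : Fin s) : ℝ :=
  breakRatio hsk a j * ∏ i with i < j, (1 - breakRatio hsk a i)

@[fun_prop] theorem continuous_firstVertex (hsk : s ≤ k) : Continuous (firstVertex hsk) := by
  unfold firstVertex; fun_prop

theorem firstVertex_mem (hs : 1 ≤ s) (hsk : s ≤ k) {a : Fin k → ℝ}
    (ha : a ∈ stdSimplex ℝ (Fin k)) : firstVertex hsk a ∈ stdSimplex ℝ (Fin s) := by
  refine ⟨fun j => mul_nonneg (breakRatio_mem hsk ha j).1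
    (Finset.prod_nonneg fun i _ => sub_nonneg.2 (breakRatio_mem hsk ha i).2), ?_⟩
  have h := Finset.prod_one_sub_ordered Finset.univ (breakRatio hsk a)
  -- The last ratio is 1, so nothing of the stick is left over.
  rw [Finset.prod_eq_zero (Finset.mem_univ ⟨s - 1, by omega⟩)
    (by rw [breakRatio, if_pos (Nat.sub_add_cancel hs), sub_self])] at h
  unfold firstVertex
  linarith

/-- A vertex surviving truncation has level 1, so the stick is used up there and no later vertex
receives weight. -/
theorem supportBelow_firstVertex (hsk : s ≤ k) (a : Fin k → ℝ) :
    SupportBelow (truncate a) (firstVertex hsk a) := by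
  intro u j hu hj
  by_contra! huj
  refine hj (mul_eq_zero_of_right _ (Finset.prod_eq_zero (i := ⟨u, huj.trans j.2⟩)
    (Finset.mem_filter.2 ⟨Finset.mem_univ _, huj⟩) ?_))
  have : ¬ (u : ℕ) + 1 = s := by omega
  simp only [breakRatio, this, if_false, Fin.castLE_mk, Fin.eta, level_of_truncate_ne_zero hu,
    sub_self]

/-- A vertex `j` with weight is either the last one, which satisfies every bound, or in the support
of `a`, where the spread hypothesis applies. -/
theorem supportAbove_firstVertex (hsk : s ≤ k) {a : Fin k → ℝ}
    (h : ∀ u w, a u ≠ 0 → a w ≠ 0 → (w : ℕ) + s ≤ u + k) :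
    SupportAbove (truncate a) (firstVertex hsk a) := by
  intro u j hu hj
  by_cases hjs : (j : ℕ) + 1 = s
  · omega
  · refine h (j.castLE hsk) u (fun h' => hj ?_) (mt truncate_eq_zero hu)
    simp [firstVertex, breakRatio, hjs, level_eq_zero h']

/-- The broken line from the first vertex through `firstVertex` to the last vertex. -/
noncomputable def bridge (hs : 1 ≤ s) (hsk : s ≤ k) (p : (Fin k → ℝ) × ℝ) : Fin s → ℝ :=
  max (1 - 2 * p.2) 0 • Pi.single ⟨0, by omega⟩ 1 +
    ((1 - max (1 - 2 * p.2) 0 - max (2 * p.2 - 1) 0) • firstVertex hsk p.1 +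
      max (2 * p.2 - 1) 0 • Pi.single ⟨s - 1, by omega⟩ 1)

@[fun_prop] theorem continuous_bridge (hs : 1 ≤ s) (hsk : s ≤ k) :
    Continuous (bridge hs hsk) := by
  unfold bridge; fun_prop

variable {a : Fin k → ℝ}

theorem SupportBelow.smul_add {b b' : Fin s → ℝ} (h : SupportBelow a b) (h' : SupportBelow a b')
    (x y : ℝ) : SupportBelow a (x • b + y • b') := by
  intro u j hu hj
  by_cases hb : b j = 0
  · exact h' u j hu fun hb' => hj (by simp [hb, hb'])
  · exact h u j hu hb

theorem SupportAbove.smul_add {b b' : Fin s → ℝ} (h : SupportAbove a b) (h' : SupportAbove a b')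
    (x y : ℝ) : SupportAbove a (x • b + y • b') := by
  intro u j hu hj
  by_cases hb : b j = 0
  · exact h' u j hu fun hb' => hj (by simp [hb, hb'])
  · exact h u j hu hb

theorem supportBelow_single_zero (hs : 1 ≤ s) : SupportBelow a (Pi.single (⟨0, by omega⟩ : Fin s) 1) := by
  intro u j _ hj
  rw [Pi.single_apply, ne_eq, ite_eq_right_iff, Classical.not_imp] at hj
  simp [hj.1]

theorem supportAbove_single_last (hs : 1 ≤ s) : SupportAbove a (Pi.single (⟨s - 1, by omega⟩ : Fin s) 1) := by
  intro u j _ hj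
  rw [Pi.single_apply, ne_eq, ite_eq_right_iff, Classical.not_imp] at hj
  simp only [hj.1]
  omega

variable (hs : 1 ≤ s) (hsk : s ≤ k) {t : ℝ}

theorem bridge_of_le (ht : t ≤ 1 / 2) : bridge hs hsk (a, t) =
    (1 - 2 * t) • Pi.single ⟨0, by omega⟩ 1 + (2 * t) • firstVertex hsk a := by
  simp only [bridge]
  rw [max_eq_left (by linarith), max_eq_right (by linarith)]
  simp

theorem bridge_of_ge (ht : 1 / 2 ≤ t) : bridge hs hsk (a, t) =
    (2 - 2 * t) • firstVertex hsk a + (2 * t - 1) • Pi.single ⟨s - 1, by omega⟩ 1 := by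
  simp only [bridge]
  rw [max_eq_right (by linarith), max_eq_left (by linarith), zero_smul, zero_add]
  congr 2
  ring

theorem bridge_mem (ha : a ∈ stdSimplex ℝ (Fin k)) (h0 : 0 ≤ t) (h1 : t ≤ 1) :
    bridge hs hsk (a, t) ∈ stdSimplex ℝ (Fin s) := by
  have hm := firstVertex_mem hs hsk ha
  rcases le_total t (1 / 2) with h | h
  · rw [bridge_of_le hs hsk h]
    exact convex_stdSimplex ℝ _ (single_mem_stdSimplex ℝ _) hm (by linarith) (by linarith) (by ring)
  · rw [bridge_of_ge hs hsk h]
    exact convex_stdSimplex ℝ _ hm (single_mem_stdSimplex ℝ _) (by linarith) (by linarith) (by ring)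

theorem supportBelow_bridge (ht : t ≤ 1 / 2) : SupportBelow (truncate a) (bridge hs hsk (a, t)) := by
  rw [bridge_of_le hs hsk ht]
  exact (supportBelow_single_zero hs).smul_add (supportBelow_firstVertex hsk a) _ _

/-- At `t = 1` nothing is known about `a`, but there the bridge is the last vertex, which lies above
every support. -/
theorem supportAbove_bridge (ht : 1 / 2 ≤ t) (ht1 : t ≤ 1)
    (h : 0 < t → t < 1 → a ∈ geomRealization (nerveComplex k (2 * k - (s + k)))) :
    HasWideGap s (truncate a) ∨ SupportAbove (truncate a) (bridge hs hsk (a, t)) := by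
  rw [bridge_of_ge hs hsk ht]
  rcases ht1.eq_or_lt with rfl | ht1
  · refine .inr ?_
    norm_num
    exact supportAbove_single_last hs
  · rcases ((mem_geomRealization_nerveComplex_sub hs hsk).1 (h (by linarith) ht1)).2 with h | h
    · exact .inl (h.mono fun u => truncate_eq_zero)
    · exact .inr ((supportAbove_firstVertex hsk h).smul_add (supportAbove_single_last hs) _ _)

theorem bridge_mem_jointFaces {p : (Fin k → ℝ) × ℝ}
    (hp : p ∈ cappedCylinder (stdSimplex ℝ (Fin k))
      (geomRealization (nerveComplex k (2 * k - (s + k))))) :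
    (truncate p.1, bridge hs hsk p) ∈ jointFaces s k := by
  refine ⟨truncate_mem hp.1, bridge_mem hs hsk hp.1 hp.2.1 hp.2.2.1, ?_⟩
  rcases le_total p.2 (1 / 2) with h | h
  · exact .inr (.inl (supportBelow_bridge hs hsk h))
  · exact (supportAbove_bridge hs hsk h hp.2.2.1 hp.2.2.2).imp_right .inr

end Bridge

/-! ### The height function separating the two pieces of a fibre -/

section Height

variable {s k : ℕ}

/-- A function that vanishes on the points whose support has a wide gap. -/
noncomputable def gapDefect (s : ℕ) (a : Fin k → ℝ) : ℝ :=
  ∏ i ∈ Finset.Icc (s - 1) k, ∑ u with (u : Fin k).1 < i ∧ i < u.1 + s, level a u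

noncomputable def belowDefect (a : Fin k → ℝ) (b : Fin s → ℝ) : ℝ :=
  ∑ u : Fin k, ∑ j : Fin s, if (u : ℕ) < j then level a u * b j else 0

noncomputable def aboveDefect (a : Fin k → ℝ) (b : Fin s → ℝ) : ℝ :=
  ∑ u : Fin k, ∑ j : Fin s, if (j : ℕ) + k < u + s then level a u * b j else 0

/-- The value is 1/2 over wide gaps, at most 1/2 on the below piece and at least 1/2 on the above
piece. Off the subcomplex, the defect bounds by 1 force the clamp to 0 or 1. -/
noncomputable def height (p : (Fin k → ℝ) × (Fin s → ℝ)) : ℝ :=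
  max 0 (min 1 (1 / 2 + gapDefect s p.1 * (belowDefect p.1 p.2 - aboveDefect p.1 p.2) / 2))

@[fun_prop] theorem continuous_height : Continuous (height (s := s) (k := k)) := by
  unfold height gapDefect belowDefect aboveDefect
  have h (c : Prop) [Decidable c] (u : Fin k) (j : Fin s) :
      Continuous fun p : (Fin k → ℝ) × (Fin s → ℝ) => if c then level p.1 u * p.2 j else 0 := by
    split_ifs <;> fun_prop
  fun_prop

theorem height_nonneg (p : (Fin k → ℝ) × (Fin s → ℝ)) : 0 ≤ height p := le_max_left _ _

theorem height_le_one (p : (Fin k → ℝ) × (Fin s → ℝ)) : height p ≤ 1 :=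
  max_le zero_le_one (min_le_left _ _)

variable {a : Fin k → ℝ} {b : Fin s → ℝ}

theorem gapDefect_nonneg (ha : a ∈ stdSimplex ℝ (Fin k)) : 0 ≤ gapDefect s a :=
  Finset.prod_nonneg fun _ _ => Finset.sum_nonneg fun _ _ => level_nonneg ha _

theorem gapDefect_eq_zero (h : HasWideGap s a) : gapDefect s a = 0 := by
  obtain ⟨i, h1, h2, h3⟩ := h
  refine Finset.prod_eq_zero (i := i) (by simp; omega) (Finset.sum_eq_zero fun u hu => ?_)
  simp only [Finset.mem_filter, Finset.mem_univ, true_and] at hu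
  by_contra h
  have := h3 u (mt level_eq_zero h)
  omega

theorem one_le_gapDefect (ha : a ∈ stdSimplex ℝ (Fin k)) (h : ¬ HasWideGap s (truncate a)) :
    1 ≤ gapDefect s a := by
  rw [← Finset.prod_const_one (s := Finset.Icc (s - 1) k)]
  refine Finset.prod_le_prod (fun _ _ => zero_le_one) fun i hi => ?_
  simp only [Finset.mem_Icc] at hi
  simp only [HasWideGap, not_exists, not_and, not_forall, not_or, not_le] at h
  obtain ⟨u, hu, h1⟩ := h i (by omega) hi.2
  rw [← level_of_truncate_ne_zero hu]
  exact Finset.single_le_sum (f := level a) (fun u _ => level_nonneg ha u) (by simpa using h1)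

theorem belowDefect_nonneg (ha : a ∈ stdSimplex ℝ (Fin k)) (hb : b ∈ stdSimplex ℝ (Fin s)) :
    0 ≤ belowDefect a b :=
  Finset.sum_nonneg fun u _ => Finset.sum_nonneg fun j _ => by
    split_ifs
    exacts [mul_nonneg (level_nonneg ha u) (hb.1 j), le_rfl]

theorem aboveDefect_nonneg (ha : a ∈ stdSimplex ℝ (Fin k)) (hb : b ∈ stdSimplex ℝ (Fin s)) :
    0 ≤ aboveDefect a b :=
  Finset.sum_nonneg fun u _ => Finset.sum_nonneg fun j _ => by
    split_ifs
    exacts [mul_nonneg (level_nonneg ha u) (hb.1 j), le_rfl]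

theorem belowDefect_eq_zero (h : SupportBelow a b) : belowDefect a b = 0 :=
  Finset.sum_eq_zero fun u _ => Finset.sum_eq_zero fun j _ => by
    split_ifs with huj
    · by_contra hne
      have := h u j (mt level_eq_zero (left_ne_zero_of_mul hne)) (right_ne_zero_of_mul hne)
      omega
    · rfl

theorem aboveDefect_eq_zero (h : SupportAbove a b) : aboveDefect a b = 0 :=
  Finset.sum_eq_zero fun u _ => Finset.sum_eq_zero fun j _ => by
    split_ifs with huj
    · by_contra hne
      have := h u j (mt level_eq_zero (left_ne_zero_of_mul hne)) (right_ne_zero_of_mul hne)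
      omega
    · rfl

theorem height_le_half (ha : a ∈ stdSimplex ℝ (Fin k)) (hb : b ∈ stdSimplex ℝ (Fin s))
    (h : HasWideGap s a ∨ SupportBelow a b) : height (a, b) ≤ 1 / 2 := by
  refine max_le (by norm_num) ((min_le_right _ _).trans ?_)
  have := gapDefect_nonneg (s := s) ha
  have := aboveDefect_nonneg ha hb
  rcases h with h | h
  · simp [gapDefect_eq_zero h]
  · simp only [belowDefect_eq_zero h]
    nlinarith

theorem half_le_height (ha : a ∈ stdSimplex ℝ (Fin k)) (hb : b ∈ stdSimplex ℝ (Fin s))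
    (h : HasWideGap s a ∨ SupportAbove a b) : 1 / 2 ≤ height (a, b) := by
  refine le_max_of_le_right (le_min (by norm_num) ?_)
  have := gapDefect_nonneg (s := s) ha
  have := belowDefect_nonneg ha hb
  rcases h with h | h
  · simp [gapDefect_eq_zero h]
  · simp only [aboveDefect_eq_zero h]
    nlinarith

/-- If `u` and `w` violate the spread bound, every `j` satisfies `u < j` or `j + k < w + s`. Both
levels are 1, so each `b j` is counted at least once, and these sum to 1. -/
theorem one_le_belowDefect_add_aboveDefect (ha : a ∈ stdSimplex ℝ (Fin k))
    (hb : b ∈ stdSimplex ℝ (Fin s))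
    (h : ¬ ∀ u w, truncate a u ≠ 0 → truncate a w ≠ 0 → (w : ℕ) + s ≤ u + k) :
    1 ≤ belowDefect a b + aboveDefect a b := by
  push Not at h
  obtain ⟨u, w, hu, hw, h⟩ := h
  have nonneg (c : Prop) [Decidable c] (v : Fin k) (j : Fin s) :
      0 ≤ if c then level a v * b j else 0 := by
    split_ifs
    exacts [mul_nonneg (level_nonneg ha v) (hb.1 j), le_rfl]
  have h1 : ∑ j : Fin s, (if (u : ℕ) < j then level a u * b j else 0) ≤ belowDefect a b :=
    Finset.single_le_sum (f := fun v : Fin k => ∑ j : Fin s, if (v : ℕ) < j then level a v * b j else 0)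
      (fun v _ => Finset.sum_nonneg fun j _ => nonneg _ v j) (Finset.mem_univ u)
  have h2 : ∑ j : Fin s, (if (j : ℕ) + k < w + s then level a w * b j else 0) ≤ aboveDefect a b :=
    Finset.single_le_sum
      (f := fun v : Fin k => ∑ j : Fin s, if (j : ℕ) + k < v + s then level a v * b j else 0)
      (fun v _ => Finset.sum_nonneg fun j _ => nonneg _ v j) (Finset.mem_univ w)
  refine le_trans ?_ (add_le_add h1 h2)
  rw [← hb.2, ← Finset.sum_add_distrib]
  refine Finset.sum_le_sum fun j _ => ?_
  rw [level_of_truncate_ne_zero hu, level_of_truncate_ne_zero hw, one_mul]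
  have := hb.1 j
  split_ifs <;> first | omega | linarith

theorem height_eq_zero (hs : 1 ≤ s) (hsk : s ≤ k) (ha : a ∈ stdSimplex ℝ (Fin k))
    (hb : b ∈ stdSimplex ℝ (Fin s))
    (h : truncate a ∉ geomRealization (nerveComplex k (2 * k - (s + k))))
    (h' : SupportBelow a b) : height (a, b) = 0 := by
  rw [mem_geomRealization_nerveComplex_sub hs hsk, and_iff_right (truncate_mem ha), not_or] at h
  have h1 := one_le_gapDefect ha h.1
  have h2 := one_le_belowDefect_add_aboveDefect ha hb h.2
  rw [belowDefect_eq_zero h'] at h2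
  refine max_eq_left ((min_le_right _ _).trans ?_)
  simp only [belowDefect_eq_zero h']
  nlinarith

theorem height_eq_one (hs : 1 ≤ s) (hsk : s ≤ k) (ha : a ∈ stdSimplex ℝ (Fin k))
    (hb : b ∈ stdSimplex ℝ (Fin s))
    (h : truncate a ∉ geomRealization (nerveComplex k (2 * k - (s + k))))
    (h' : SupportAbove a b) : height (a, b) = 1 := by
  rw [mem_geomRealization_nerveComplex_sub hs hsk, and_iff_right (truncate_mem ha), not_or] at h
  have h1 := one_le_gapDefect ha h.1
  have h2 := one_le_belowDefect_add_aboveDefect ha hb h.2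
  rw [aboveDefect_eq_zero h'] at h2
  have : (1 : ℝ) ≤ 1 / 2 + gapDefect s a * (belowDefect a b - aboveDefect a b) / 2 := by
    rw [aboveDefect_eq_zero h']
    nlinarith
  simp only [height]
  rw [min_eq_left this, max_eq_right zero_le_one]

theorem height_eq_zero_or_one (hs : 1 ≤ s) (hsk : s ≤ k) (h : (a, b) ∈ jointFaces s k)
    (h' : truncate a ∉ geomRealization (nerveComplex k (2 * k - (s + k)))) :
    height (a, b) = 0 ∨ height (a, b) = 1 := by
  obtain ⟨ha, hb, hg | hb' | ha'⟩ := h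
  · exact absurd ((mem_geomRealization_nerveComplex_sub hs hsk).2
      ⟨truncate_mem ha, .inl (hg.mono fun u => truncate_eq_zero)⟩) h'
  · exact .inl (height_eq_zero hs hsk ha hb h' hb')
  · exact .inr (height_eq_one hs hsk ha hb h' ha')

theorem truncate_height_mem (hs : 1 ≤ s) (hsk : s ≤ k) {p : (Fin k → ℝ) × (Fin s → ℝ)}
    (hp : p ∈ jointFaces s k) : (truncate p.1, height p) ∈ cappedCylinder (stdSimplex ℝ (Fin k))
      (geomRealization (nerveComplex k (2 * k - (s + k)))) := by
  refine ⟨truncate_mem hp.1, height_nonneg _, height_le_one _, fun h0 h1 => ?_⟩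
  by_contra h
  rcases height_eq_zero_or_one hs hsk hp h with h' | h'
  · exact h0.ne' h'
  · exact h1.ne h'

end Height

/-! ### The equivalence for joint faces, and the theorem -/

noncomputable def jointFacesEquiv {s k : ℕ} (hs : 1 ≤ s) (hsk : s ≤ k) :
    ContinuousMap.HomotopyEquiv (jointFaces s k) (cappedCylinder (stdSimplex ℝ (Fin k))
      (geomRealization (nerveComplex k (2 * k - (s + k))))) where
  toFun := ⟨fun p => ⟨_, truncate_height_mem hs hsk p.2⟩, by fun_prop⟩
  invFun := ⟨fun p => ⟨_, bridge_mem_jointFaces hs hsk p.2⟩, by fun_prop⟩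
  left_inv := by
    let M : C(jointFaces s k, jointFaces s k) := ⟨fun p => ⟨(truncate (truncate p.1.1), p.1.2),
      jointFaces_of_support p.2 (truncate_mem (truncate_mem p.2.1)) p.2.2.1
        truncate_truncate_eq_zero fun _ => id⟩, by fun_prop⟩
    refine (ContinuousMap.Homotopic.trans (g := M) ?_ ?_).symm
    · refine ContinuousMap.homotopic_of_segment _ _ fun p r h0 h1 => ?_
      exact jointFaces_of_support p.2
        (convex_stdSimplex ℝ _ p.2.1 (M p).2.1 (by linarith) h0 (by ring))
        (convex_stdSimplex ℝ _ p.2.2.1 (M p).2.2.1 (by linarith) h0 (by ring))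
        (fun u hu => by simp [M, hu, truncate_truncate_eq_zero u hu])
        (fun j hj => by simp [M, hj])
    · refine ContinuousMap.homotopic_of_segment _ _ fun p r h0 h1 => ?_
      obtain ⟨⟨a, b⟩, hp⟩ := p
      have hq := truncate_height_mem hs hsk hp
      obtain ⟨ha, hb, h⟩ := id hp
      have hB := bridge_mem hs hsk (truncate_mem ha) (height_nonneg (a, b))
        (height_le_one _)
      change ((1 - r) • truncate (truncate a) + r • truncate (truncate a),
        (1 - r) • b + r • bridge hs hsk (truncate a, height (a, b))) ∈ jointFaces s k
      rw [← add_smul, sub_add_cancel, one_smul]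
      refine ⟨truncate_mem (truncate_mem ha),
        convex_stdSimplex ℝ _ hb hB (by linarith) h0 (by ring), ?_⟩
      -- The height lies in the half of the bridge belonging to the piece containing `b`, so the
      -- segment from `b` stays in one face.
      rcases h with h | h | h
      · exact .inl (h.mono truncate_truncate_eq_zero)
      · exact .inr (.inl ((h.mono truncate_truncate_eq_zero fun _ => id).smul_add
          (supportBelow_bridge hs hsk (height_le_half ha hb (.inr h))) _ _))
      · exact (supportAbove_bridge hs hsk (half_le_height ha hb (.inr h)) (height_le_one _)
          hq.2.2.2).imp_right fun h' => .inr
            ((h.mono truncate_truncate_eq_zero fun _ => id).smul_add h' _ _)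
  right_inv := by
    let N : C(cappedCylinder (stdSimplex ℝ (Fin k))
        (geomRealization (nerveComplex k (2 * k - (s + k)))), cappedCylinder (stdSimplex ℝ (Fin k))
        (geomRealization (nerveComplex k (2 * k - (s + k))))) :=
      ⟨fun p => ⟨(truncate (truncate p.1.1), p.1.2), truncate_mem (truncate_mem p.2.1),
        p.2.2.1, p.2.2.2.1, fun h0 h1 => mem_geomRealization_of_support (p.2.2.2.2 h0 h1)
          (truncate_mem (truncate_mem p.2.1)) truncate_truncate_eq_zero⟩, by fun_prop⟩
    refine (ContinuousMap.Homotopic.trans (g := N) ?_ ?_).symm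
    · refine ContinuousMap.homotopic_of_segment _ _ fun p r h0 h1 => ?_
      obtain ⟨⟨a, t⟩, ha, ht0, ht1, ht⟩ := p
      change ((1 - r) • a + r • truncate (truncate a), (1 - r) • t + r • t) ∈ cappedCylinder _ _
      rw [← add_smul, sub_add_cancel, one_smul]
      have hc := convex_stdSimplex ℝ _ ha (truncate_mem (truncate_mem ha))
        (sub_nonneg.2 h1) h0 (by ring)
      exact ⟨hc, ht0, ht1, fun k0 k1 => mem_geomRealization_of_support (ht k0 k1) hc
        fun u (hu : a u = 0) => by simp [hu, truncate_truncate_eq_zero u hu]⟩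
    -- The height is free to move over the subcomplex. Off it, `t` is 0 or 1, and the new height is
    -- 0 or 1 on the same side of 1/2, hence equal to `t`.
    · refine cappedCylinder.homotopic_of_fst_eq _ _ (fun _ => rfl) fun p => ?_
      refine or_iff_not_imp_left.2 fun hW => ?_
      obtain ⟨⟨a, t⟩, hp⟩ := p
      have hY := bridge_mem_jointFaces hs hsk hp
      obtain ⟨ha, ht0, ht1, ht⟩ := id hp
      change truncate (truncate a) ∉ _ at hW
      change t = height (truncate a, bridge hs hsk (a, t))
      have hB := bridge_mem hs hsk ha ht0 ht1
      have haW : a ∉ geomRealization (nerveComplex k (2 * k - (s + k))) := fun h =>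
        hW (mem_geomRealization_of_support h (truncate_mem (truncate_mem ha))
          truncate_truncate_eq_zero)
      have hh := height_eq_zero_or_one hs hsk hY hW
      rcases ht0.eq_or_lt with rfl | ht0
      · have := height_le_half (truncate_mem ha) hB
          (.inr (supportBelow_bridge hs hsk (by norm_num)))
        rcases hh with hh | hh
        · exact hh.symm
        · rw [hh] at this; norm_num at this
      · rcases ht1.eq_or_lt with rfl | ht1
        · have := half_le_height (truncate_mem ha) hB
            (supportAbove_bridge hs hsk (by norm_num) le_rfl ht)
          rcases hh with hh | hh
          · rw [hh] at this; norm_num at this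
          · exact hh.symm
        · exact absurd (ht ht0 ht1) haW

theorem proposition3p5 (n k : ℕ) (hnk : (n : ℝ) / 2 ≤ (k : ℝ)) (hkn : k < n) :
    Nonempty (ContinuousMap.HomotopyEquiv
      (geomRealization (nerveComplex n k))
      (Suspension (Suspension (geomRealization (nerveComplex k (2 * k - n)))))) := by
  have h2 : n ≤ 2 * k := by
    have : (n : ℝ) ≤ 2 * k := by linarith
    exact_mod_cast this
  obtain ⟨s, rfl⟩ : ∃ s, n = s + k := ⟨n - k, by omega⟩
  have hs : 1 ≤ s := by omega
  have hsk : s ≤ k := by omega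
  have ha₀ := single_mem_stdSimplex ℝ (⟨0, by omega⟩ : Fin k)
  have hb₀ := single_mem_stdSimplex ℝ (⟨0, by omega⟩ : Fin s)
  have e₁ := cappedCylinder.homotopyEquivSuspension (C := stdSimplex ℝ (Fin k))
    (W := geomRealization (nerveComplex k (2 * k - (s + k))))
    (convex_stdSimplex ℝ _) (fun _ h => h.1) ha₀
  have e₂ := cappedCylinder.homotopyEquivSuspension
    (C := stdSimplex ℝ (Fin k) ×ˢ stdSimplex ℝ (Fin s)) (W := jointFaces s k)
    ((convex_stdSimplex ℝ _).prod (convex_stdSimplex ℝ _)) (fun _ h => ⟨h.1, h.2.1⟩)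
    (Set.mk_mem_prod ha₀ hb₀)
  exact ⟨(nerveComplexSplit hs hsk).trans (e₂.trans
    (Suspension.homotopyEquiv ((jointFacesEquiv hs hsk).trans e₁)))⟩
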